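/- Let $n\in\mathbb{N}$. A polytope in $\mathbb{R}^n$ is the convex hull of a finite set of points, and a polyhedron in $\mathbb{R}^n$ is a finite (possibly empty) union of polytopes. Let $P\subseteq\mathbb{R}^n$ be a polyhedron with the subspace topology, let $\mathrm{Sub}_c(P)$ be the set of polyhedra in $\mathbb{R}^n$ contained in $P$, and let $\mathrm{Sub}_o(P)=\{O\subseteq P : P\setminus O\in\mathrm{Sub}_c(P)\}$. Let $\mathrm{K}(P)$ and $\mathrm{Op}(P)$ be the lattices of closed and of open subsets of $P$. (1) All members of $\mathrm{Sub}_c(P)$ are closed in $P$, and $\mathrm{Sub}_c(P)$ is a co-Heyting subalgebra of $\mathrm{K}(P)$: it contains $\emptyset$ and $P$ and is closed under $\cup$, $\cap$ and the co-Heyting implication of $\mathrm{K}(P)$, which is $C\leftarrow D=\mathrm{cl}(C\setminus D)$ for all $C,D\in\mathrm{K}(P)$. Here, for $C,D\in\mathrm{Sub}_c(P)$, the closure may equally be taken in $\mathbb{R}^n$. (2) Dually, all members of $\mathrm{Sub}_o(P)$ are open in $P$, and $\mathrm{Sub}_o(P)$ is a Heyting subalgebra of $\mathrm{Op}(P)$: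 it contains $\emptyset$ and $P$ and is closed under $\cup$, $\cap$ and the Heyting implication of $\mathrm{Op}(P)$, which is $U\to V=\mathrm{int}((P\setminus U)\cup V)$ for all $U,V\in\mathrm{Op}(P)$, the interior being taken in $P$. -/

import Mathlib

open TopologicalSpace Set

/-- A polytope in `ℝⁿ`: the convex hull of a finite set of points. -/
def IsPolytope {n : ℕ} (T : Set (EuclideanSpace ℝ (Fin n))) : Prop :=
  ∃ V : Set (EuclideanSpace ℝ (Fin n)), V.Finite ∧ T = convexHull ℝ V

/-- A (compact) polyhedron in `ℝⁿ`: a finite, possibly empty, union of polytopes. -/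
def IsPolyhedron {n : ℕ} (S : Set (EuclideanSpace ℝ (Fin n))) : Prop :=
  ∃ F : Set (Set (EuclideanSpace ℝ (Fin n))),
    F.Finite ∧ (∀ T ∈ F, IsPolytope T) ∧ S = ⋃₀ F

/-- `Sub_c(P)`: the polyhedra in `ℝⁿ` contained in `P`. -/
def SubC {n : ℕ} (P : Set (EuclideanSpace ℝ (Fin n))) :
    Set (Set (EuclideanSpace ℝ (Fin n))) :=
  {Q | IsPolyhedron Q ∧ Q ⊆ P}

/-- `Sub_o(P)`: the subsets `O` of `P` whose complement in `P` belongs to `Sub_c(P)`. -/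
def SubO {n : ℕ} (P : Set (EuclideanSpace ℝ (Fin n))) :
    Set (Set (EuclideanSpace ℝ (Fin n))) :=
  {O | O ⊆ P ∧ P \ O ∈ SubC P}

/-- `Sub_c(P)` as a family of elements of the lattice of closed sets of the space `P`. -/
def closedSubpolyhedra {n : ℕ} (P : Set (EuclideanSpace ℝ (Fin n))) : Set (Closeds P) :=
  {C | ((↑) '' (C : Set P) : Set (EuclideanSpace ℝ (Fin n))) ∈ SubC P}

/-- `Sub_o(P)` as a family of elements of the lattice of open sets of the space `P`. -/
def openSubpolyhedra {n : ℕ} (P : Set (EuclideanSpace ℝ (Fin n))) : Set (Opens P) :=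
  {U | ((↑) '' (U : Set P) : Set (EuclideanSpace ℝ (Fin n))) ∈ SubO P}

/-- A subset of a Heyting algebra that contains the bounds and is closed under
meets, joins and Heyting implication. -/
structure IsHeytingSubalgebra {α : Type*} [HeytingAlgebra α] (S : Set α) : Prop where
  bot_mem : ⊥ ∈ S
  top_mem : ⊤ ∈ S
  sup_mem : ∀ a ∈ S, ∀ b ∈ S, a ⊔ b ∈ S
  inf_mem : ∀ a ∈ S, ∀ b ∈ S, a ⊓ b ∈ S
  himp_mem : ∀ a ∈ S, ∀ b ∈ S, a ⇨ b ∈ S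

/-- A subset of a co-Heyting algebra that contains the bounds and is closed under
meets, joins and co-Heyting implication `a ← b`, which Mathlib writes `a \ b`. -/
structure IsCoheytingSubalgebra {α : Type*} [CoheytingAlgebra α] (S : Set α) : Prop where
  bot_mem : ⊥ ∈ S
  top_mem : ⊤ ∈ S
  sup_mem : ∀ a ∈ S, ∀ b ∈ S, a ⊔ b ∈ S
  inf_mem : ∀ a ∈ S, ∀ b ∈ S, a ⊓ b ∈ S
  sdiff_mem : ∀ a ∈ S, ∀ b ∈ S, a \ b ∈ S

/-!
A polytope `T` is an intersection of finitely many closed half-spaces, and conversely a closed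
half-space cuts a polytope in a polytope. These two facts make everything computable.

* For the second, `f ≤ c` cuts the hull of a finite set `S` in the hull of the points of `S` with
  `f ≤ c` and of the points where segments between points of `S` cross `f = c`
  (`exists_finite_convexHull_inter_halfSpace`).
* For the first, pass to the cone over `T` in `E × ℝ`. A finitely generated cone is cut out by
  finitely many linear inequalities, by induction on the number of generators: adjoining a generator
  `v` to a cone means projecting along `v`, which is Fourier–Motzkin elimination
  (`exists_finite_convexHull_eq_inequalities`).

So intersections of polyhedra are polyhedra. As for differences, if `D` is the intersection of
half-spaces `Hᵢ`, then `T \ D` is the union of the sets `T \ Hᵢ`, and by convexity the closure of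
`T \ Hᵢ` is either empty or the intersection of `T` with the half-space opposite to `Hᵢ`.
Closure commutes with finite unions, which settles the co-Heyting implication
(`IsPolyhedron.closure_diff`). The statement on open sets follows by taking complements in `P`,
which exchange `U ⇨ V` and `Vᶜ \ Uᶜ`.
-/

/-! ### Cutting a polytope by a half-space -/

open Pointwise in
/-- Let `f p ≤ c < f q`. The segment from `p` to `q` crosses the hyperplane `f = c` at the weighted
mean of `p` and `q` with weights `f q - c` and `c - f p`. If such crossing points lie in a convex
set `K` whenever `p ∈ V` and `q ∈ W`, they do so for all `p` in the hull of `V` and `q` in the hull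
of `W`: the condition, multiplied by `f q - f p`, is affine in `p` and in `q`. -/
theorem crossing_mem_smul_of_mem_convexHull {E : Type*} [AddCommGroup E] [Module ℝ E]
    {f : E →ₗ[ℝ] ℝ} {c : ℝ} {V W K : Set E} (hK : Convex ℝ K)
    (hV : ∀ v ∈ V, f v ≤ c) (hW : ∀ w ∈ W, c < f w)
    (h : ∀ v ∈ V, ∀ w ∈ W, (f w - c) • v + (c - f v) • w ∈ (f w - f v) • K)
    {p q : E} (hp : p ∈ convexHull ℝ V) (hq : q ∈ convexHull ℝ W) :
    f p ≤ c ∧ c < f q ∧ (f q - c) • p + (c - f p) • q ∈ (f q - f p) • K := by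
  have key : ∀ q, c < f q →
      Convex ℝ {p | f p ≤ c ∧ (f q - c) • p + (c - f p) • q ∈ (f q - f p) • K} := by
    rintro q hq p₁ ⟨hp₁, h₁⟩ p₂ ⟨hp₂, h₂⟩ a b ha hb hab
    obtain rfl : b = 1 - a := by linarith
    refine ⟨by simp only [map_add, map_smul, smul_eq_mul]; nlinarith, ?_⟩
    have e : f q - f (a • p₁ + (1 - a) • p₂)
        = a * (f q - f p₁) + (1 - a) * (f q - f p₂) := by
      simp only [map_add, map_smul, smul_eq_mul]; ring
    rw [e, hK.add_smul (by nlinarith) (by nlinarith), mul_smul, mul_smul]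
    convert add_mem_add (smul_mem_smul_set (a := a) h₁) (smul_mem_smul_set (a := 1 - a) h₂) using 1
    simp only [map_add, map_smul, smul_eq_mul]
    module
  have key' : ∀ p, f p ≤ c →
      Convex ℝ {q | c < f q ∧ (f q - c) • p + (c - f p) • q ∈ (f q - f p) • K} := by
    rintro p hp q₁ ⟨hq₁, h₁⟩ q₂ ⟨hq₂, h₂⟩ a b ha hb hab
    have hf : c < f (a • q₁ + b • q₂) :=
      (convex_halfSpace_gt f.isLinear c) hq₁ hq₂ ha hb hab
    obtain rfl : b = 1 - a := by linarith
    refine ⟨hf, ?_⟩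
    have e : f (a • q₁ + (1 - a) • q₂) - f p
        = a * (f q₁ - f p) + (1 - a) * (f q₂ - f p) := by
      simp only [map_add, map_smul, smul_eq_mul]; ring
    rw [e, hK.add_smul (mul_nonneg ha (by linarith)) (mul_nonneg hb (by linarith)),
      mul_smul, mul_smul]
    convert add_mem_add (smul_mem_smul_set (a := a) h₁) (smul_mem_smul_set (a := 1 - a) h₂) using 1
    simp only [map_add, map_smul, smul_eq_mul]
    module
  have hp' : f p ≤ c := convexHull_min hV (convex_halfSpace_le f.isLinear c) hp
  refine ⟨hp', convexHull_min (fun w hw ↦ ?_) (key' p hp') hq⟩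
  have hpw := convexHull_min (fun v hv ↦ ?_) (key w (hW w hw)) hp
  · exact ⟨hW w hw, hpw.2⟩
  · exact ⟨hV v hv, h v hv w hw⟩

/-- A closed half-space cuts the convex hull of a finite set `S` in the hull of a finite set: the
points of `S` in the half-space, and the points where segments between points of `S` cross the
bounding hyperplane. -/
theorem exists_finite_convexHull_inter_halfSpace {E : Type*} [AddCommGroup E] [Module ℝ E]
    (f : E →ₗ[ℝ] ℝ) (c : ℝ) {S : Set E} (hS : S.Finite) :
    ∃ Z : Set E, Z.Finite ∧ convexHull ℝ S ∩ {x | f x ≤ c} = convexHull ℝ Z := by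
  set V := {x ∈ S | f x ≤ c}
  set W := {x ∈ S | c < f x}
  have hVfin : V.Finite := hS.subset (sep_subset _ _)
  have hWfin : W.Finite := hS.subset (sep_subset _ _)
  have hSVW : S = V ∪ W := by
    ext x
    simp only [V, W, mem_union, mem_ofPred_eq]
    have := le_or_gt (f x) c
    tauto
  set z : E → E → E := fun v w ↦ (f w - f v)⁻¹ • ((f w - c) • v + (c - f v) • w) with hz
  have hZfin : (V ∪ image2 z V W).Finite := hVfin.union (hVfin.image2 _ hWfin)
  refine ⟨V ∪ image2 z V W, hZfin, Subset.antisymm ?_ ?_⟩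
  · rintro x ⟨hx, hxc⟩
    have hxc : f x ≤ c := hxc
    rcases W.eq_empty_or_nonempty with hW | hW
    · rw [hSVW, hW, union_empty] at hx
      exact convexHull_mono subset_union_left hx
    rcases V.eq_empty_or_nonempty with hV | hV
    · rw [hSVW, hV, empty_union] at hx
      have : c < f x :=
        convexHull_min (fun w hw ↦ hw.2) (convex_halfSpace_gt f.isLinear c) hx
      exact absurd hxc this.not_ge
    rw [hSVW, convexHull_union hV hW] at hx
    obtain ⟨p, hp, q, hq, a, b, ha, hb, hab, rfl⟩ := mem_convexJoin.1 hx
    obtain ⟨hpc, hqc, k, hk, hkz⟩ := crossing_mem_smul_of_mem_convexHull (f := f) (c := c)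
      (convex_convexHull ℝ (V ∪ image2 z V W)) (fun v hv ↦ hv.2) (fun w hw ↦ hw.2)
      (fun v hv w hw ↦ by
        refine ⟨z v w, subset_convexHull ℝ _ (Or.inr (mem_image2_of_mem hv hw)), ?_⟩
        have : f w - f v ≠ 0 := by linarith [hv.2, hw.2]
        simp only [hz, smul_smul, mul_inv_cancel₀ this, one_smul]) hp hq
    have hpK := convexHull_mono (subset_union_left (t := image2 z V W)) hp
    have hqc' : 0 < f q - c := sub_pos.2 hqc
    have hd : 0 < f q - f p := by linarith
    -- `a • p + b • q` lies between `p` and the crossing point `k`, whose weight is chosen so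
    -- that the coefficients of `q` agree.
    simp only [map_add, map_smul, smul_eq_mul] at hxc
    obtain rfl : a = 1 - b := by linarith
    rcases eq_or_lt_of_le hpc with hpc | hpc
    · obtain rfl : b = 0 := by
        refine le_antisymm ?_ hb
        by_contra! hb'
        nlinarith
      simpa using hpK
    have hcp : 0 < c - f p := sub_pos.2 hpc
    have hle : b * (f q - f p) / (c - f p) ≤ 1 := by
      rw [div_le_one hcp]; nlinarith
    have hxk := (convex_convexHull ℝ (V ∪ image2 z V W)) hpK hk (sub_nonneg.2 hle)
      (by positivity : 0 ≤ b * (f q - f p) / (c - f p)) (by ring)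
    convert hxk using 1
    have hkz : (f q - f p) • k = (f q - c) • p + (c - f p) • q := hkz
    have hk' : k = (f q - f p)⁻¹ • ((f q - c) • p + (c - f p) • q) := by
      rw [← hkz, smul_smul, inv_mul_cancel₀ hd.ne', one_smul]
    rw [hk']
    match_scalars
    · field_simp
      ring
    · field_simp
  · refine convexHull_min ?_ ((convex_convexHull ℝ S).inter (convex_halfSpace_le f.isLinear c))
    rintro _ (hx | ⟨v, hv, w, hw, rfl⟩)
    · exact ⟨subset_convexHull ℝ _ hx.1, hx.2⟩
    · have hvc : 0 ≤ c - f v := sub_nonneg.2 hv.2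
      have hwc : 0 < f w - c := sub_pos.2 hw.2
      have hd : 0 < f w - f v := by linarith
      constructor
      · convert (convex_convexHull ℝ S) (subset_convexHull ℝ _ hv.1) (subset_convexHull ℝ _ hw.1)
          (by positivity : 0 ≤ (f w - c) / (f w - f v))
          (by positivity : 0 ≤ (c - f v) / (f w - f v)) (by field_simp; ring) using 1
        simp only [hz]
        match_scalars <;> field_simp
      · simp only [hz, mem_ofPred_eq, map_add, map_smul, smul_eq_mul]
        apply le_of_eq
        field_simp
        ring

/-! ### Polytopes as intersections of half-spaces -/

/-- Fourier–Motzkin elimination of the nonnegative parameter `t`: a finite system of lower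
and upper bounds on `t` is solvable exactly when each lower bound is at most each upper bound. -/
theorem exists_finite_fourier_motzkin {F : Type*} [AddCommGroup F] [Module ℝ F]
    {G : Set (F →ₗ[ℝ] ℝ)} (hG : G.Finite) (v : F) :
    ∃ G' : Set (F →ₗ[ℝ] ℝ), G'.Finite ∧
      ∀ x, (∃ t : ℝ, 0 ≤ t ∧ ∀ g ∈ G, 0 ≤ g (x - t • v)) ↔ ∀ g ∈ G', 0 ≤ g x := by
  refine ⟨{g ∈ G | 0 ≤ g v} ∪
    image2 (fun g h ↦ g v • h - h v • g) {g ∈ G | 0 < g v} {h ∈ G | h v < 0},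
    (hG.subset (sep_subset _ _)).union
      ((hG.subset (sep_subset _ _)).image2 _ (hG.subset (sep_subset _ _))), fun x ↦ ?_⟩
  simp only [map_sub, map_smul, smul_eq_mul]
  constructor
  · rintro ⟨t, ht, h⟩ _ (⟨hg, hgv⟩ | ⟨g, ⟨hg, hgv⟩, k, ⟨hk, hkv⟩, rfl⟩)
    · nlinarith [h _ hg]
    · have h₁ := mul_nonneg hgv.le (h k hk)
      have h₂ := mul_nonneg (neg_nonneg.2 hkv.le) (h g hg)
      simp only [LinearMap.sub_apply, LinearMap.smul_apply, smul_eq_mul]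
      linarith
  · intro h
    obtain ⟨t, htL, ht⟩ := Set.exists_max_image
      (insert 0 ((fun k : F →ₗ[ℝ] ℝ ↦ k x / k v) '' {k ∈ G | k v < 0})) id
      (((hG.subset (sep_subset _ _)).image _).insert 0) (insert_nonempty _ _)
    have ht0 : 0 ≤ t := ht 0 (mem_insert _ _)
    refine ⟨t, ht0, fun g hg ↦ ?_⟩
    rcases lt_trichotomy (g v) 0 with hgv | hgv | hgv
    · have : g x / g v ≤ t := ht _ (Or.inr ⟨g, ⟨hg, hgv⟩, rfl⟩)
      rw [div_le_iff_of_neg hgv] at this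
      linarith
    · simpa [hgv] using h g (Or.inl ⟨hg, hgv.ge⟩)
    · rcases htL with rfl | ⟨k, ⟨hk, hkv⟩, rfl⟩
      · simpa using h g (Or.inl ⟨hg, hgv.le⟩)
      · have := h _ (Or.inr ⟨g, ⟨hg, hgv⟩, k, ⟨hk, hkv⟩, rfl⟩)
        simp only [LinearMap.sub_apply, LinearMap.smul_apply, smul_eq_mul] at this
        have e : g x - k x / k v * g v = (g v * k x - k v * g x) / (-k v) := by
          field_simp [hkv.ne]
          ring
        rw [e]
        exact div_nonneg this (by linarith)

/-- One half of the Minkowski–Weyl theorem for cones: a finitely generated cone is cut out by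
finitely many linear inequalities. Adjoining a generator is one elimination step. -/
theorem exists_finite_hull_eq_inequalities {F : Type*} [AddCommGroup F] [Module ℝ F]
    [FiniteDimensional ℝ F] {S : Set F} (hS : S.Finite) :
    ∃ G : Set (F →ₗ[ℝ] ℝ), G.Finite ∧
      ∀ x, x ∈ PointedCone.hull ℝ S ↔ ∀ g ∈ G, 0 ≤ g x := by
  induction S, hS using Set.Finite.induction_on with
  | empty =>
    let b := Module.finBasis ℝ F
    refine ⟨range b.coord ∪ range (fun i ↦ -b.coord i),
      (finite_range _).union (finite_range _), fun x ↦ ?_⟩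
    simp only [PointedCone.hull, Submodule.span_empty, Submodule.mem_bot]
    constructor
    · rintro rfl
      simp
    · intro h
      refine b.ext_elem fun i ↦ ?_
      have h₁ := h _ (Or.inl ⟨i, rfl⟩)
      have h₂ := h _ (Or.inr ⟨i, rfl⟩)
      simp at h₁ h₂ ⊢
      linarith
  | @insert v S _ _ ih =>
    obtain ⟨G, hG, h⟩ := ih
    obtain ⟨G', hG', h'⟩ := exists_finite_fourier_motzkin hG v
    refine ⟨G', hG', fun x ↦ ?_⟩
    rw [← h', PointedCone.hull, Submodule.mem_span_insert]
    constructor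
    · rintro ⟨a, z, hz, rfl⟩
      refine ⟨a, a.2, (h _).1 ?_⟩
      convert hz using 1
      exact add_sub_cancel_left _ _
    · rintro ⟨t, ht, hx⟩
      exact ⟨⟨t, ht⟩, x - t • v, (h _).2 hx, (add_sub_cancel (t • v) x).symm⟩

open Pointwise in
/-- The convex hull of a finite set is an intersection of finitely many closed half-spaces: it is
the slice at height `1` of the cone over it in `E × ℝ`. -/
theorem exists_finite_convexHull_eq_inequalities {E : Type*} [AddCommGroup E] [Module ℝ E]
    [FiniteDimensional ℝ E] {S : Set E} (hS : S.Finite) :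
    ∃ G : Set ((E →ₗ[ℝ] ℝ) × ℝ), G.Finite ∧
      convexHull ℝ S = {x | ∀ g ∈ G, g.1 x ≤ g.2} := by
  rcases S.eq_empty_or_nonempty with rfl | hne
  · refine ⟨{(0, -1)}, finite_singleton _, ?_⟩
    ext x
    simp only [convexHull_empty, mem_empty_iff_false, mem_singleton_iff, forall_eq,
      mem_ofPred_eq, LinearMap.zero_apply, false_iff]
    norm_num
  obtain ⟨G, hG, h⟩ := exists_finite_hull_eq_inequalities
    (hS.image (fun v : E ↦ ((v, 1) : E × ℝ)))
  have hslice : ∀ x, x ∈ convexHull ℝ S ↔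
      ((x, 1) : E × ℝ) ∈ PointedCone.hull ℝ ((fun v : E ↦ ((v, 1) : E × ℝ)) '' S) := by
    intro x
    constructor
    · refine fun hx ↦ convexHull_min 
        (t := {x | ((x, 1) : E × ℝ) ∈ PointedCone.hull ℝ ((fun v : E ↦ ((v, 1) : E × ℝ)) '' S)})
        (fun v hv ↦ PointedCone.subset_hull (mem_image_of_mem (fun v : E ↦ ((v, 1) : E × ℝ)) hv)) ?_ hx
      intro p hp q hq a b ha hb hab
      have := (PointedCone.convex (PointedCone.hull ℝ ((fun v : E ↦ ((v, 1) : E × ℝ)) '' S)))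
        (show ((p, 1) : E × ℝ) ∈ _ from hp) (show ((q, 1) : E × ℝ) ∈ _ from hq) ha hb hab
      simpa [hab] using this
    · intro hx
      have hK := convex_convexHull ℝ S
      have : ∀ y ∈ PointedCone.hull ℝ ((fun v : E ↦ ((v, 1) : E × ℝ)) '' S),
          0 ≤ y.2 ∧ y.1 ∈ y.2 • convexHull ℝ S := by
        intro y hy
        refine Submodule.span_induction ?_ ?_ ?_ ?_ hy
        · rintro _ ⟨v, hv, rfl⟩
          simpa using subset_convexHull ℝ _ hv
        · simp [zero_smul_set hne.convexHull]
        · rintro y z _ _ ⟨hy, hy'⟩ ⟨hz, hz'⟩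
          refine ⟨add_nonneg hy hz, ?_⟩
          rw [Prod.snd_add, hK.add_smul hy hz]
          exact add_mem_add hy' hz'
        · rintro a y _ ⟨hy, hy'⟩
          refine ⟨mul_nonneg a.2 hy, ?_⟩
          change (a : ℝ) • y.1 ∈ ((a : ℝ) * y.2) • convexHull ℝ S
          rw [mul_smul]
          exact smul_mem_smul_set hy'
      simpa using (this _ hx).2
  refine ⟨(fun g ↦ (-(g ∘ₗ LinearMap.inl ℝ E ℝ), g (0, 1))) '' G, hG.image _, ?_⟩
  ext x
  rw [hslice, h]
  simp only [forall_mem_image, mem_ofPred_eq]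
  refine forall₂_congr fun g _ ↦ ?_
  have : g (x, 1) = g (x, 0) + g (0, 1) := by rw [← map_add]; simp
  simp only [this, LinearMap.neg_apply, LinearMap.comp_apply, LinearMap.inl_apply]
  constructor <;> intro <;> linarith

/-! ### Operations on polyhedra -/

section Polyhedra

variable {n : ℕ}

theorem IsPolytope.convex {T : Set (EuclideanSpace ℝ (Fin n))} (hT : IsPolytope T) :
    Convex ℝ T := by
  obtain ⟨V, _, rfl⟩ := hT
  exact convex_convexHull ℝ V

theorem IsPolytope.isClosed {T : Set (EuclideanSpace ℝ (Fin n))} (hT : IsPolytope T) :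
    IsClosed T := by
  obtain ⟨V, hV, rfl⟩ := hT
  exact hV.isClosed_convexHull ℝ

theorem isPolytope_empty : IsPolytope (∅ : Set (EuclideanSpace ℝ (Fin n))) :=
  ⟨∅, finite_empty, convexHull_empty.symm⟩

theorem IsPolytope.inter_halfSpace {T : Set (EuclideanSpace ℝ (Fin n))} (hT : IsPolytope T)
    (f : EuclideanSpace ℝ (Fin n) →ₗ[ℝ] ℝ) (c : ℝ) : IsPolytope (T ∩ {x | f x ≤ c}) := by
  obtain ⟨V, hV, rfl⟩ := hT
  exact exists_finite_convexHull_inter_halfSpace f c hV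

theorem IsPolytope.exists_finite_inequalities {T : Set (EuclideanSpace ℝ (Fin n))}
    (hT : IsPolytope T) : ∃ G : Set ((EuclideanSpace ℝ (Fin n) →ₗ[ℝ] ℝ) × ℝ), G.Finite ∧
      T = {x | ∀ g ∈ G, g.1 x ≤ g.2} := by
  obtain ⟨V, hV, rfl⟩ := hT
  exact exists_finite_convexHull_eq_inequalities hV

theorem IsPolytope.inter {T D : Set (EuclideanSpace ℝ (Fin n))} (hT : IsPolytope T)
    (hD : IsPolytope D) : IsPolytope (T ∩ D) := by
  obtain ⟨G, hG, rfl⟩ := hD.exists_finite_inequalities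
  clear hD
  induction G, hG using Set.Finite.induction_on with
  | empty => simpa using hT
  | @insert g G _ _ ih =>
    convert ih.inter_halfSpace g.1 g.2 using 1
    ext x
    simp only [mem_insert_iff, forall_eq_or_imp, mem_inter_iff, mem_ofPred_eq]
    tauto

/-- A segment from a point `x` of `T` with `c ≤ f x` to a point of `T` with `c < f` lies, but for
`x`, in the open half-space. Hence `T`, cut by an open half-space that meets it, has as closure its
cut by the closed half-space. -/
theorem IsPolytope.closure_diff_halfSpace {T : Set (EuclideanSpace ℝ (Fin n))}
    (hT : IsPolytope T) (f : EuclideanSpace ℝ (Fin n) →ₗ[ℝ] ℝ) (c : ℝ) :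
    IsPolytope (closure (T \ {x | f x ≤ c})) := by
  rcases (T \ {x | f x ≤ c}).eq_empty_or_nonempty with h | ⟨y, hyT, hy⟩
  · rw [h, closure_empty]
    exact isPolytope_empty
  have hy : c < f y := not_le.1 hy
  convert hT.inter_halfSpace (-f) (-c) using 1
  have hf : Continuous f := f.continuous_of_finiteDimensional
  refine Subset.antisymm (closure_minimal ?_ (hT.isClosed.inter (isClosed_le (by fun_prop)
    continuous_const))) ?_
  · rintro x ⟨hxT, hx⟩
    have hx : c < f x := not_le.1 hx
    exact ⟨hxT, show -f x ≤ -c from neg_le_neg hx.le⟩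
  · rintro x ⟨hxT, hx⟩
    have hx : c ≤ f x := neg_le_neg_iff.1 hx
    have hsub : openSegment ℝ x y ⊆ T \ {x | f x ≤ c} := by
      refine fun z hz ↦ ⟨hT.convex.openSegment_subset hxT hyT hz, ?_⟩
      change ¬ f z ≤ c
      rw [not_le]
      obtain ⟨a, b, ha, hb, hab, rfl⟩ := hz
      obtain rfl : a = 1 - b := by linarith
      simp only [map_add, map_smul, smul_eq_mul]
      nlinarith
    refine closure_mono hsub ?_
    rw [closure_openSegment]
    exact left_mem_segment ℝ x y

theorem IsPolytope.isPolyhedron {T : Set (EuclideanSpace ℝ (Fin n))} (hT : IsPolytope T) :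
    IsPolyhedron T :=
  ⟨{T}, finite_singleton T, by simpa using hT, (sUnion_singleton T).symm⟩

theorem IsPolyhedron.union {C D : Set (EuclideanSpace ℝ (Fin n))} (hC : IsPolyhedron C)
    (hD : IsPolyhedron D) : IsPolyhedron (C ∪ D) := by
  obtain ⟨A, hA, hA', rfl⟩ := hC
  obtain ⟨B, hB, hB', rfl⟩ := hD
  refine ⟨A ∪ B, hA.union hB, ?_, (sUnion_union A B).symm⟩
  rintro T (hT | hT)
  exacts [hA' T hT, hB' T hT]

theorem isPolyhedron_biUnion {ι : Type*} {I : Set ι} (hI : I.Finite)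
    {s : ι → Set (EuclideanSpace ℝ (Fin n))} (h : ∀ i ∈ I, IsPolyhedron (s i)) :
    IsPolyhedron (⋃ i ∈ I, s i) := by
  induction I, hI using Set.Finite.induction_on with
  | empty => simpa using isPolytope_empty.isPolyhedron
  | insert _ _ ih =>
    rw [biUnion_insert]
    exact (h _ (mem_insert _ _)).union (ih fun i hi ↦ h i (mem_insert_of_mem _ hi))

theorem IsPolyhedron.isClosed {C : Set (EuclideanSpace ℝ (Fin n))} (hC : IsPolyhedron C) :
    IsClosed C := by
  obtain ⟨A, hA, hA', rfl⟩ := hC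
  rw [sUnion_eq_biUnion]
  exact hA.isClosed_biUnion fun T hT ↦ (hA' T hT).isClosed

theorem IsPolyhedron.inter {C D : Set (EuclideanSpace ℝ (Fin n))} (hC : IsPolyhedron C)
    (hD : IsPolyhedron D) : IsPolyhedron (C ∩ D) := by
  obtain ⟨A, hA, hA', rfl⟩ := hC
  obtain ⟨B, hB, hB', rfl⟩ := hD
  rw [sUnion_inter_sUnion]
  exact isPolyhedron_biUnion (hA.prod hB)
    fun p hp ↦ ((hA' _ hp.1).inter (hB' _ hp.2)).isPolyhedron

theorem IsPolytope.isPolyhedron_closure_diff {T D : Set (EuclideanSpace ℝ (Fin n))}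
    (hT : IsPolytope T) (hD : IsPolytope D) : IsPolyhedron (closure (T \ D)) := by
  obtain ⟨G, hG, rfl⟩ := hD.exists_finite_inequalities
  have : T \ {x | ∀ g ∈ G, g.1 x ≤ g.2} = ⋃ g ∈ G, T \ {x | g.1 x ≤ g.2} := by
    ext x
    simp
  rw [this, hG.closure_biUnion]
  exact isPolyhedron_biUnion hG fun g _ ↦ (hT.closure_diff_halfSpace g.1 g.2).isPolyhedron

/-- The polytopes making up `D` can be removed one at a time with a closure after each step,
since `closure (closure X \ T) = closure (X \ T)` for closed `T`. -/
theorem IsPolyhedron.closure_diff {C D : Set (EuclideanSpace ℝ (Fin n))} (hC : IsPolyhedron C)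
    (hD : IsPolyhedron D) : IsPolyhedron (closure (C \ D)) := by
  obtain ⟨B, hB, hB', rfl⟩ := hD
  induction B, hB using Set.Finite.induction_on with
  | empty => simpa [hC.isClosed.closure_eq] using hC
  | @insert T B _ _ ih =>
    have hT := hB' T (mem_insert _ _)
    have e : closure (C \ ⋃₀ insert T B) = closure (closure (C \ ⋃₀ B) \ T) := by
      rw [sUnion_insert, union_comm, ← sdiff_sdiff]
      refine Subset.antisymm (closure_mono (sdiff_subset_sdiff_left subset_closure))
        (closure_minimal ?_ isClosed_closure)
      exact hT.isClosed.isOpen_compl.closure_inter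
    obtain ⟨A, hA, hA', hCA⟩ := ih fun T hT ↦ hB' T (mem_insert_of_mem _ hT)
    have : (⋃ S ∈ A, S) \ T = ⋃ S ∈ A, S \ T := by simp only [iUnion_sdiff]
    rw [e, hCA, sUnion_eq_biUnion, this, hA.closure_biUnion]
    exact isPolyhedron_biUnion hA fun S hS ↦ (hA' S hS).isPolyhedron_closure_diff hT

end Polyhedra

/-! ### The lattices of closed and of open sets -/

theorem coe_closeds_sdiff {X : Type*} [TopologicalSpace X] (C D : Closeds X) :
    ((C \ D : Closeds X) : Set X) = closure ((C : Set X) \ D) := by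
  have h : C \ D = Closeds.closure ((C : Set X) \ D) := by
    refine le_antisymm (sdiff_le_iff.2 ?_) ?_
    · rw [← SetLike.coe_subset_coe, Closeds.coe_sup, ← sdiff_subset_iff]
      exact subset_closure
    · refine closure_minimal ?_ (C \ D).isClosed
      rw [sdiff_subset_iff, ← Closeds.coe_sup, SetLike.coe_subset_coe]
      exact le_sup_sdiff
  rw [h, Closeds.coe_closure]

theorem compl_opens_himp {X : Type*} [TopologicalSpace X] (U V : Opens X) :
    (U ⇨ V).compl = V.compl \ U.compl := by
  apply Closeds.ext
  rw [coe_closeds_sdiff, Opens.coe_compl, Opens.coe_himp, himp_eq, ← closure_compl]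
  congr 1
  ext x
  simp

theorem isCoheytingSubalgebra_closedSubpolyhedra {n : ℕ} {P : Set (EuclideanSpace ℝ (Fin n))}
    (hP : IsPolyhedron P) : IsCoheytingSubalgebra (closedSubpolyhedra P) where
  bot_mem := by
    simpa [closedSubpolyhedra, SubC] using isPolytope_empty.isPolyhedron
  top_mem := by
    simpa [closedSubpolyhedra, SubC] using hP
  sup_mem C hC D hD := by
    refine ⟨?_, Subtype.coe_image_subset P _⟩
    rw [Closeds.coe_sup, image_union]
    exact hC.1.union hD.1
  inf_mem C hC D hD := by
    refine ⟨?_, Subtype.coe_image_subset P _⟩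
    rw [Closeds.coe_inf, image_inter Subtype.val_injective]
    exact hC.1.inter hD.1
  sdiff_mem C hC D hD := by
    refine ⟨?_, Subtype.coe_image_subset P _⟩
    rw [coe_closeds_sdiff, ← hP.isClosed.isClosedEmbedding_subtypeVal.closure_image_eq,
      image_sdiff Subtype.val_injective]
    exact hC.1.closure_diff hD.1

theorem mem_openSubpolyhedra_iff {n : ℕ} {P : Set (EuclideanSpace ℝ (Fin n))} {U : Opens P} :
    U ∈ openSubpolyhedra P ↔ U.compl ∈ closedSubpolyhedra P := by
  have : P \ ((↑) '' (U : Set P)) = (↑) '' (U.compl : Set P) := by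
    rw [Opens.coe_compl, image_compl_eq_range_sdiff_image Subtype.val_injective, Subtype.range_coe]
  simp only [openSubpolyhedra, closedSubpolyhedra, SubO, mem_ofPred_eq, this,
    Subtype.coe_image_subset, true_and]

theorem isHeytingSubalgebra_openSubpolyhedra {n : ℕ} {P : Set (EuclideanSpace ℝ (Fin n))}
    (hP : IsPolyhedron P) : IsHeytingSubalgebra (openSubpolyhedra P) := by
  have h := isCoheytingSubalgebra_closedSubpolyhedra hP
  constructor
  · rw [mem_openSubpolyhedra_iff]
    convert h.top_mem
    ext; simp
  · rw [mem_openSubpolyhedra_iff]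
    convert h.bot_mem
    ext; simp
  · intro U hU V hV
    rw [mem_openSubpolyhedra_iff] at *
    convert h.inf_mem _ hU _ hV
    ext; simp
  · intro U hU V hV
    rw [mem_openSubpolyhedra_iff] at *
    convert h.sup_mem _ hU _ hV
    ext; simp [or_iff_not_imp_left]
  · intro U hU V hV
    rw [mem_openSubpolyhedra_iff] at *
    rw [compl_opens_himp]
    exact h.sdiff_mem _ hV _ hU

/-- For a polyhedron `P` in `ℝⁿ`, the subpolyhedra of `P` form a co-Heyting subalgebra of the
closed sets of `P`, and the open subpolyhedra of `P` a Heyting subalgebra of the open sets of `P`.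
The implications are those of the lattices of all closed and of all open sets of `P`, namely
`cl (C ∖ D)` and `int ((P ∖ U) ∪ V)`. -/
theorem corollary3p4 (n : ℕ) (P : Set (EuclideanSpace ℝ (Fin n))) (hP : IsPolyhedron P) :
    (Set.BijOn
        (fun C : Closeds P => ((↑) '' (C : Set P) : Set (EuclideanSpace ℝ (Fin n))))
        (closedSubpolyhedra P) (SubC P) ∧
      (∀ C D : Closeds P,
        ((C \ D : Closeds P) : Set P) = closure ((C : Set P) \ (D : Set P))) ∧
      (∀ C ∈ SubC P, ∀ D ∈ SubC P, closure (C \ D) ∈ SubC P) ∧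
      IsCoheytingSubalgebra (closedSubpolyhedra P)) ∧
    (Set.BijOn
        (fun U : Opens P => ((↑) '' (U : Set P) : Set (EuclideanSpace ℝ (Fin n))))
        (openSubpolyhedra P) (SubO P) ∧
      (∀ U V : Opens P,
        ((U ⇨ V : Opens P) : Set P) = interior ((U : Set P)ᶜ ∪ (V : Set P))) ∧
      IsHeytingSubalgebra (openSubpolyhedra P)) := by
  have hinj : Function.Injective
      (image ((↑) : P → EuclideanSpace ℝ (Fin n))) := Subtype.val_injective.image_injective
  refine ⟨⟨⟨fun _ h ↦ h, fun C _ D _ h ↦ SetLike.coe_injective (hinj h), ?_⟩, coe_closeds_sdiff,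
    ?_, isCoheytingSubalgebra_closedSubpolyhedra hP⟩, ⟨fun _ h ↦ h,
    fun U _ V _ h ↦ SetLike.coe_injective (hinj h), ?_⟩, ?_,
    isHeytingSubalgebra_openSubpolyhedra hP⟩
  · intro Q hQ
    have e : ((↑) '' (((↑) : P → _) ⁻¹' Q) : Set (EuclideanSpace ℝ (Fin n))) = Q := by
      rw [Subtype.image_preimage_coe, inter_eq_right.2 hQ.2]
    refine ⟨⟨_, hQ.1.isClosed.preimage continuous_subtype_val⟩, ?_, e⟩
    simpa only [closedSubpolyhedra, mem_ofPred_eq, Closeds.coe_mk, e] using hQ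
  · intro C hC D hD
    exact ⟨hC.1.closure_diff hD.1, closure_minimal (sdiff_subset.trans hC.2) hP.isClosed⟩
  · intro O hO
    have e : ((↑) '' (((↑) : P → _) ⁻¹' O) : Set (EuclideanSpace ℝ (Fin n))) = O := by
      rw [Subtype.image_preimage_coe, inter_eq_right.2 hO.1]
    have ho : IsOpen (((↑) : P → EuclideanSpace ℝ (Fin n)) ⁻¹' O) := by
      convert (hO.2.1.isClosed.preimage (continuous_subtype_val (p := (· ∈ P)))).isOpen_compl
      ext x
      simp
    refine ⟨⟨_, ho⟩, ?_, e⟩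
    simpa only [openSubpolyhedra, mem_ofPred_eq, Opens.coe_mk, e] using hO
  · intro U V
    rw [Opens.coe_himp, himp_eq]
    exact congrArg interior (union_comm _ _)
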